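/- Let $(B,g_B)$ and $(F,g_F)$ be connected finite-dimensional smooth semi-Riemannian manifolds (without boundary), let $f:B\to(0,\infty)$ be a smooth function, and let $M=B\times_f F$ be their warped product, i.e. the product manifold $B\times F$ with the semi-Riemannian metric $\tilde g=\pi^*g_B+(f\circ\pi)^2\,\sigma^*g_F$, where $\pi:B\times F\to B$ and $\sigma:B\times F\to F$ are the projections. Suppose that $(M,\tilde g)$ is a gradient Ricci soliton with potential function $h:M\to\mathbb{R}$; that is, $h$ is twice continuously differentiable and there is a constant $\rho\in\mathbb{R}$ with $$\mathrm{Ric}_{\tilde g}+\mathrm{Hess}_{\tilde g}(h)=\rho\,\tilde g .$$ Suppose moreover that there are a point $x\in B$ and tangent vectors $v,w\in T_xB$ such that $\mathrm{Hess}_{g_B}(f)(v,w)\neq 0$. Then $h$ depends only on the base: there is a function $h_B:B\to\mathbb{R}$ such that $h=h_B\circ\pi$. -/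

import Mathlib

open scoped Manifold ContDiff Topology

set_option maxSynthPendingDepth 3

noncomputable section

/-! ### Local formulas on a vector space

`G : E → E →L[ℝ] E →L[ℝ] ℝ` is a field of bilinear forms on (an open subset of) `E`. -/

section Local

variable {E : Type*} [NormedAddCommGroup E] [NormedSpace ℝ E]

/-- The Christoffel symbols of the first kind of `G` at `u`, doubled:
`v, w, z ↦ D_v G(w, z) + D_w G(v, z) - D_z G(v, w)`. -/
def christoffelLower (G : E → E →L[ℝ] E →L[ℝ] ℝ) (u : E) : E →L[ℝ] E →L[ℝ] E →L[ℝ] ℝ :=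
  letI dG : E →L[ℝ] E →L[ℝ] E →L[ℝ] ℝ := fderiv ℝ G u
  letI swap : (E →L[ℝ] E →L[ℝ] ℝ) →L[ℝ] E →L[ℝ] E →L[ℝ] ℝ :=
    (ContinuousLinearMap.flipₗᵢ ℝ E E ℝ).toContinuousLinearEquiv
  dG + dG.flip - swap.comp dG.flip

theorem christoffelLower_apply (G : E → E →L[ℝ] E →L[ℝ] ℝ) (u v w z : E) :
    christoffelLower G u v w z
      = fderiv ℝ G u v w z + fderiv ℝ G u w v z - fderiv ℝ G u z v w := by
  simp [christoffelLower]

/-- The Christoffel symbols (of the second kind) of the Levi-Civita connection of `G` at `u`, as a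
bilinear map `(v, w) ↦ Γ(v, w)`. When `G u` is nondegenerate and `E` is finite dimensional,
`(G u).inverse` is the isomorphism from covectors to vectors given by `G u`, so that `Γ(v, w)` is
the unique vector with `G u (Γ(v, w)) z = (D_v G(w, z) + D_w G(v, z) - D_z G(v, w)) / 2`. -/
def christoffel (G : E → E →L[ℝ] E →L[ℝ] ℝ) (u : E) : E →L[ℝ] E →L[ℝ] E :=
  (1 / 2 : ℝ) •
    (ContinuousLinearMap.compL ℝ E (E →L[ℝ] ℝ) E (G u).inverse ∘L christoffelLower G u)

theorem christoffel_apply (G : E → E →L[ℝ] E →L[ℝ] ℝ) (u v w : E) :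
    christoffel G u v w = (1 / 2 : ℝ) • (G u).inverse (christoffelLower G u v w) := by
  simp [christoffel]

/-- The curvature of `G` at `u`, for fixed `y`, `z`, as the linear map `x ↦ R(x, y) z`, where
`R(x, y) z = (D_x Γ)(y, z) - (D_y Γ)(x, z) + Γ(x, Γ(y, z)) - Γ(y, Γ(x, z))`, that is
`R(X, Y) Z = ∇_X ∇_Y Z - ∇_Y ∇_X Z - ∇_[X,Y] Z`. -/
def curvatureEnd (G : E → E →L[ℝ] E →L[ℝ] ℝ) (u y z : E) : E →L[ℝ] E :=
  ((fderiv ℝ (christoffel G) u).flip y).flip z - (fderiv ℝ (christoffel G) u y).flip z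
    + (christoffel G u).flip (christoffel G u y z)
    - (christoffel G u y) ∘L (christoffel G u).flip z

theorem curvatureEnd_apply (G : E → E →L[ℝ] E →L[ℝ] ℝ) (u x y z : E) :
    curvatureEnd G u y z x
      = fderiv ℝ (christoffel G) u x y z - fderiv ℝ (christoffel G) u y x z
        + christoffel G u x (christoffel G u y z) - christoffel G u y (christoffel G u x z) := by
  simp [curvatureEnd]

/-- The Ricci curvature of `G` at `u`: `Ric(y, z)` is the trace of `x ↦ R(x, y) z`. -/
def localRicci (G : E → E →L[ℝ] E →L[ℝ] ℝ) (u y z : E) : ℝ :=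
  LinearMap.trace ℝ E (curvatureEnd G u y z : E →ₗ[ℝ] E)

/-- The Hessian of `h` at `u` with respect to `G`: `D²h(v, w) - Dh(Γ(v, w))`. -/
def localHessian (G : E → E →L[ℝ] E →L[ℝ] ℝ) (h : E → ℝ) (u v w : E) : ℝ :=
  fderiv ℝ (fderiv ℝ h) u v w - fderiv ℝ h u (christoffel G u v w)

end Local

/-! ### Semi-Riemannian metrics, Ricci tensor and Hessian on a manifold -/

section Manifold

variable {E : Type*} [NormedAddCommGroup E] [NormedSpace ℝ E]
  {H : Type*} [TopologicalSpace H] (I : ModelWithCorners ℝ E H)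
  {M : Type*} [TopologicalSpace M] [ChartedSpace H M]

/-- The expression of a field of bilinear forms on the tangent spaces of `M` in the chart around
`p`: the pull-back of `g` by the inverse of that chart. -/
def coordForm (g : ∀ x : M, TangentSpace I x →L[ℝ] TangentSpace I x →L[ℝ] ℝ) (p : M) (u : E) :
    E →L[ℝ] E →L[ℝ] ℝ :=
  letI D : E →L[ℝ] TangentSpace I ((extChartAt I p).symm u) :=
    mfderiv 𝓘(ℝ, E) I (extChartAt I p).symm u
  (ContinuousLinearMap.precomp ℝ D) ∘L (g ((extChartAt I p).symm u)) ∘L D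

variable (M) in
/-- A semi-Riemannian metric on a manifold without boundary: a symmetric nondegenerate bilinear
form on every tangent space whose components in charts are smooth. (On a connected manifold the
index of such a field is automatically constant.) -/
structure SemiRiemannianMetric where
  /-- the bilinear form on the tangent space at `x` -/
  val : ∀ x : M, TangentSpace I x →L[ℝ] TangentSpace I x →L[ℝ] ℝ
  symm : ∀ x v w, val x v w = val x w v
  nondegenerate : ∀ x v, (∀ w, val x v w = 0) → v = 0
  smooth : ∀ p : M, ContDiffOn ℝ ∞ (coordForm I val p) (extChartAt I p).target

variable {I}

namespace SemiRiemannianMetric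

/-- The Ricci tensor at `p`, computed in the chart around `p`. The tangent space at `p` is
identified with `E` by the differential of that same chart. -/
def ricci (g : SemiRiemannianMetric I M) (p : M) (v w : TangentSpace I p) : ℝ :=
  localRicci (coordForm I g.val p) (extChartAt I p p) v w

/-- The Hessian at `p` of a function `h` on `M`, computed in the chart around `p`. -/
def hessian (g : SemiRiemannianMetric I M) (h : M → ℝ) (p : M) (v w : TangentSpace I p) : ℝ :=
  localHessian (coordForm I g.val p) (h ∘ (extChartAt I p).symm) (extChartAt I p p) v w

/-- `(M, g)` is a gradient Ricci soliton with potential function `h`: there is a constant `ρ` with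
`Ric + Hess h = ρ g`. -/
def IsGradientRicciSoliton (g : SemiRiemannianMetric I M) (h : M → ℝ) : Prop :=
  ContMDiff I 𝓘(ℝ, ℝ) 2 h ∧
    ∃ ρ : ℝ, ∀ (p : M) (v w : TangentSpace I p),
      g.ricci p v w + g.hessian h p v w = ρ * g.val p v w

end SemiRiemannianMetric

end Manifold

/-! ### Warped products -/

section Warped

variable {E : Type*} [NormedAddCommGroup E] [NormedSpace ℝ E]
  {H : Type*} [TopologicalSpace H] {I : ModelWithCorners ℝ E H}
  {B : Type*} [TopologicalSpace B] [ChartedSpace H B]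
  {E' : Type*} [NormedAddCommGroup E'] [NormedSpace ℝ E']
  {H' : Type*} [TopologicalSpace H'] {J : ModelWithCorners ℝ E' H'}
  {F : Type*} [TopologicalSpace F] [ChartedSpace H' F]

/-- The field of bilinear forms `π^* g_B + (f ∘ π)² σ^* g_F` on `B × F`, where `π` and `σ` are the
projections onto `B` and `F`. -/
def warpedForm (gB : ∀ x : B, TangentSpace I x →L[ℝ] TangentSpace I x →L[ℝ] ℝ)
    (gF : ∀ y : F, TangentSpace J y →L[ℝ] TangentSpace J y →L[ℝ] ℝ) (f : B → ℝ) (p : B × F) :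
    TangentSpace (I.prod J) p →L[ℝ] TangentSpace (I.prod J) p →L[ℝ] ℝ :=
  letI dπ : TangentSpace (I.prod J) p →L[ℝ] TangentSpace I p.1 :=
    mfderiv (I.prod J) I Prod.fst p
  letI dσ : TangentSpace (I.prod J) p →L[ℝ] TangentSpace J p.2 :=
    mfderiv (I.prod J) J Prod.snd p
  (ContinuousLinearMap.precomp ℝ dπ) ∘L (gB p.1) ∘L dπ
    + (f p.1) ^ 2 • ((ContinuousLinearMap.precomp ℝ dσ) ∘L (gF p.2) ∘L dσ)

theorem warpedForm_apply (gB : ∀ x : B, TangentSpace I x →L[ℝ] TangentSpace I x →L[ℝ] ℝ)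
    (gF : ∀ y : F, TangentSpace J y →L[ℝ] TangentSpace J y →L[ℝ] ℝ) (f : B → ℝ) (p : B × F)
    (v w : E × E') :
    warpedForm gB gF f p v w
      = gB p.1 v.1 w.1 + f p.1 ^ 2 * gF p.2 v.2 w.2 := by
  unfold warpedForm
  rw [mfderiv_fst, mfderiv_snd]
  rfl

theorem coordForm_warpedForm [I.Boundaryless] [J.Boundaryless]
    [IsManifold I ∞ B] [IsManifold J ∞ F]
    (gB : ∀ x : B, TangentSpace I x →L[ℝ] TangentSpace I x →L[ℝ] ℝ)
    (gF : ∀ y : F, TangentSpace J y →L[ℝ] TangentSpace J y →L[ℝ] ℝ) (f : B → ℝ) (p : B × F)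
    (u : E × E') (hu : u ∈ (extChartAt (I.prod J) p).target) :
    coordForm (I.prod J) (warpedForm gB gF f) p u
      = ContinuousLinearMap.precomp ℝ (ContinuousLinearMap.fst ℝ E E') ∘L
          (coordForm I gB p.1 u.1) ∘L ContinuousLinearMap.fst ℝ E E'
        + (f ((extChartAt I p.1).symm u.1)) ^ 2 •
          (ContinuousLinearMap.precomp ℝ (ContinuousLinearMap.snd ℝ E E') ∘L
          (coordForm J gF p.2 u.2) ∘L ContinuousLinearMap.snd ℝ E E') := by
  have : IsManifold I 1 B := .of_le (n := ∞) (by norm_cast)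
  have : IsManifold J 1 F := .of_le (n := ∞) (by norm_cast)
  have hu' : u.1 ∈ (extChartAt I p.1).target ∧ u.2 ∈ (extChartAt J p.2).target := by
    rwa [extChartAt_prod] at hu
  have hd : MDifferentiableAt 𝓘(ℝ, E × E') (I.prod J) (extChartAt (I.prod J) p).symm u := by
    have := mdifferentiableWithinAt_extChartAt_symm hu
    rwa [ModelWithCorners.range_eq_univ, mdifferentiableWithinAt_univ] at this
  have hdB : MDifferentiableAt 𝓘(ℝ, E) I (extChartAt I p.1).symm u.1 := by
    have := mdifferentiableWithinAt_extChartAt_symm hu'.1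
    rwa [ModelWithCorners.range_eq_univ, mdifferentiableWithinAt_univ] at this
  have hdF : MDifferentiableAt 𝓘(ℝ, E') J (extChartAt J p.2).symm u.2 := by
    have := mdifferentiableWithinAt_extChartAt_symm hu'.2
    rwa [ModelWithCorners.range_eq_univ, mdifferentiableWithinAt_univ] at this
  have k1 : ∀ v : E × E',
      (mfderiv (I.prod J) I (Prod.fst : B × F → B) ((extChartAt (I.prod J) p).symm u))
        (mfderiv 𝓘(ℝ, E × E') (I.prod J) (extChartAt (I.prod J) p).symm u v)
      = mfderiv 𝓘(ℝ, E) I (extChartAt I p.1).symm u.1 v.1 := by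
    intro v
    have e1 := mfderiv_comp_apply (I := 𝓘(ℝ, E × E')) (I' := I.prod J) (I'' := I) u
      (g := (Prod.fst : B × F → B)) (mdifferentiableAt_fst) hd v
    have e2 := mfderiv_comp_apply (I := 𝓘(ℝ, E × E')) (I' := 𝓘(ℝ, E)) (I'' := I) u
      (f := (Prod.fst : E × E' → E)) hdB (differentiableAt_fst.mdifferentiableAt) v
    rw [mfderiv_eq_fderiv, fderiv_fst] at e2
    exact e1.symm.trans e2
  have k2 : ∀ v : E × E',
      (mfderiv (I.prod J) J (Prod.snd : B × F → F) ((extChartAt (I.prod J) p).symm u))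
        (mfderiv 𝓘(ℝ, E × E') (I.prod J) (extChartAt (I.prod J) p).symm u v)
      = mfderiv 𝓘(ℝ, E') J (extChartAt J p.2).symm u.2 v.2 := by
    intro v
    have e1 := mfderiv_comp_apply (I := 𝓘(ℝ, E × E')) (I' := I.prod J) (I'' := J) u
      (g := (Prod.snd : B × F → F)) (mdifferentiableAt_snd) hd v
    have e2 := mfderiv_comp_apply (I := 𝓘(ℝ, E × E')) (I' := 𝓘(ℝ, E')) (I'' := J) u
      (f := (Prod.snd : E × E' → E')) hdF (differentiableAt_snd.mdifferentiableAt) v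
    rw [mfderiv_eq_fderiv, fderiv_snd] at e2
    exact e1.symm.trans e2
  refine ContinuousLinearMap.ext fun v => ContinuousLinearMap.ext fun w => ?_
  have a1 : gB ((extChartAt (I.prod J) p).symm u).1 (mfderiv (I.prod J) I (Prod.fst : B × F → B)
        ((extChartAt (I.prod J) p).symm u)
        (mfderiv 𝓘(ℝ, E × E') (I.prod J) (extChartAt (I.prod J) p).symm u v))
        (mfderiv (I.prod J) I (Prod.fst : B × F → B) ((extChartAt (I.prod J) p).symm u)
        (mfderiv 𝓘(ℝ, E × E') (I.prod J) (extChartAt (I.prod J) p).symm u w))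
      = coordForm I gB p.1 u.1 v.1 w.1 := by
    rw [k1, k1]; rfl
  have a2 : gF ((extChartAt (I.prod J) p).symm u).2 (mfderiv (I.prod J) J (Prod.snd : B × F → F)
        ((extChartAt (I.prod J) p).symm u)
        (mfderiv 𝓘(ℝ, E × E') (I.prod J) (extChartAt (I.prod J) p).symm u v))
        (mfderiv (I.prod J) J (Prod.snd : B × F → F) ((extChartAt (I.prod J) p).symm u)
        (mfderiv 𝓘(ℝ, E × E') (I.prod J) (extChartAt (I.prod J) p).symm u w))
      = coordForm J gF p.2 u.2 v.2 w.2 := by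
    rw [k2, k2]; rfl
  exact congrArg₂ (fun a b : ℝ => a + f ((extChartAt I p.1).symm u.1) ^ 2 * b) a1 a2

/-- The warped product metric `g_B + f² g_F` on `B × F`. -/
def warpedProduct [I.Boundaryless] [J.Boundaryless] [IsManifold I ∞ B] [IsManifold J ∞ F]
    (gB : SemiRiemannianMetric I B) (gF : SemiRiemannianMetric J F) (f : B → ℝ)
    (hf : ContMDiff I 𝓘(ℝ, ℝ) ∞ f) (hpos : ∀ x, 0 < f x) :
    SemiRiemannianMetric (I.prod J) (B × F) where
  val := warpedForm gB.val gF.val f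
  symm p v w := by
    refine (warpedForm_apply gB.val gF.val f p v w).trans
      (Eq.trans ?_ (warpedForm_apply gB.val gF.val f p w v).symm)
    exact congrArg₂ (fun a b : ℝ => a + f p.1 ^ 2 * b) (gB.symm p.1 _ _) (gF.symm p.2 _ _)
  nondegenerate p v h := by
    obtain ⟨v₁, v₂⟩ : E × E' := v
    have h' : ∀ (w₁ : TangentSpace I p.1) (w₂ : TangentSpace J p.2),
        gB.val p.1 v₁ w₁ + f p.1 ^ 2 * gF.val p.2 v₂ w₂ = 0 := fun w₁ w₂ =>
      (warpedForm_apply gB.val gF.val f p (v₁, v₂) (w₁, w₂)).symm.trans (h (w₁, w₂))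
    have h1 : v₁ = 0 := gB.nondegenerate p.1 v₁ fun w => by
      have := h' w 0
      rwa [map_zero, mul_zero, add_zero] at this
    have h2 : v₂ = 0 := gF.nondegenerate p.2 v₂ fun w => by
      have := h' 0 w
      rw [map_zero, zero_add] at this
      exact (mul_eq_zero.1 this).resolve_left (pow_ne_zero 2 (hpos p.1).ne')
    exact Prod.ext h1 h2
  smooth p := by
    refine ContDiffOn.congr ?_ (fun u hu => coordForm_warpedForm gB.val gF.val f p u hu)
    have m1 : Set.MapsTo (Prod.fst : E × E' → E) (extChartAt (I.prod J) p).target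
        (extChartAt I p.1).target := fun u hu => by
      rw [extChartAt_prod] at hu; exact hu.1
    have m2 : Set.MapsTo (Prod.snd : E × E' → E') (extChartAt (I.prod J) p).target
        (extChartAt J p.2).target := fun u hu => by
      rw [extChartAt_prod] at hu; exact hu.2
    have s1 := (gB.smooth p.1).comp contDiff_fst.contDiffOn m1
    have s2 := (gF.smooth p.2).comp contDiff_snd.contDiffOn m2
    have sf : ContDiffOn ℝ ∞ (f ∘ (extChartAt I p.1).symm) (extChartAt I p.1).target :=
      (hf.comp_contMDiffOn (contMDiffOn_extChartAt_symm p.1)).contDiffOn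
    have sf' := sf.comp contDiff_fst.contDiffOn m1
    exact (contDiffOn_const.clm_comp (s1.clm_comp contDiffOn_const)).add
      ((sf'.pow 2).smul (contDiffOn_const.clm_comp (s2.clm_comp contDiffOn_const)))

end Warped

end

/-!
The soliton equation on `B ×_f F` has a mixed component (one horizontal and one vertical vector)
and a horizontal one; these two already determine the dependence of the potential `h` on the fibre.

In the product of two charts the Christoffel symbols of a warped product are explicit
(`christoffel_warpedLocal`). From them, the mixed component of the Ricci tensor vanishes
(`localRicci_warpedLocal_mixed`), while its horizontal component is
`Ric_B - (dim F / f) Hess_B f`, which is independent of the fibre point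
(`localRicci_warpedLocal_horizontal`). Likewise the mixed component of `Hess h` at `(X, V)` is
`X V h - (X f / f) V h`, and the horizontal component is the Hessian, on the base, of the restriction
of `h` to a horizontal leaf `B × {y}`.

The mixed equation is thus `X (V h / f) = 0`. As `B` is connected, `V h / f` does not depend on the
base point; as `F` is connected, `h (x, y) - h (x, y₀) = c f(x)` with `c` depending only on `y`
and `y₀` (`IsGradientRicciSoliton.sub_div_eq`). Subtracting the horizontal equations at `(x, y)` and
`(x, y₀)` leaves `c Hess_B f = 0` (`IsGradientRicciSoliton.localHessian_leaf_eq`). Hence `c = 0` as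
soon as `Hess_B f` is nonzero somewhere, so `h (x, y) = h (x, y₀)` for all `x`.
-/

noncomputable section

section Local

variable {E : Type*} [NormedAddCommGroup E] [NormedSpace ℝ E]
  {E' : Type*} [NormedAddCommGroup E'] [NormedSpace ℝ E']

/-! ### Metrics on open subsets of a vector space -/

/-- `G` is a smooth field of nondegenerate bilinear forms on the open set `U`. Nondegeneracy is
encoded as invertibility of `G u` as a map from vectors to covectors. -/
structure IsMetricOn (G : E → E →L[ℝ] E →L[ℝ] ℝ) (U : Set E) : Prop where
  isOpen : IsOpen U
  contDiffOn : ContDiffOn ℝ ∞ G U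
  isInvertible : ∀ u ∈ U, (G u).IsInvertible

theorem isInvertible_of_nondegenerate [FiniteDimensional ℝ E] (T : E →L[ℝ] E →L[ℝ] ℝ)
    (hT : ∀ v, (∀ w, T v w = 0) → v = 0) : T.IsInvertible := by
  have hinj : Function.Injective T := by
    refine (injective_iff_map_eq_zero T).2 fun v hv => hT v fun w => by rw [hv]; rfl
  have hdim : Module.finrank ℝ E = Module.finrank ℝ (E →L[ℝ] ℝ) := by
    rw [← (LinearMap.toContinuousLinearMap : (E →ₗ[ℝ] ℝ) ≃ₗ[ℝ] _).finrank_eq]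
    exact (Subspace.dual_finrank_eq (K := ℝ) (V := E)).symm
  let e := (LinearEquiv.ofInjectiveOfFinrankEq (T : E →ₗ[ℝ] E →L[ℝ] ℝ) hinj
    hdim).toContinuousLinearEquiv
  exact ⟨e, by ext v; rfl⟩

namespace IsMetricOn

variable {G : E → E →L[ℝ] E →L[ℝ] ℝ} {U : Set E} {u : E}

theorem differentiableAt (hG : IsMetricOn G U) (hu : u ∈ U) : DifferentiableAt ℝ G u :=
  (hG.contDiffOn.contDiffAt (hG.isOpen.mem_nhds hu)).differentiableAt (by simp)

theorem contDiffAt_christoffelLower (hG : IsMetricOn G U) (hu : u ∈ U) :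
    ContDiffAt ℝ 1 (christoffelLower G) u := by
  have h1 : ContDiffAt ℝ 1 (fderiv ℝ G) u :=
    (hG.contDiffOn.contDiffAt (hG.isOpen.mem_nhds hu)).fderiv_right (by norm_cast)
  have hflip : ContDiff ℝ 1 (fun T : E →L[ℝ] E →L[ℝ] E →L[ℝ] ℝ => T.flip) :=
    (ContinuousLinearMap.flipₗᵢ ℝ E E (E →L[ℝ] ℝ)).toContinuousLinearEquiv.contDiff
  have h2 : ContDiffAt ℝ 1 (fun u => (fderiv ℝ G u).flip) u :=
    hflip.contDiffAt.comp u h1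
  have h3 : ContDiffAt ℝ 1 (fun _ : E =>
      ((ContinuousLinearMap.flipₗᵢ ℝ E E ℝ).toContinuousLinearEquiv :
        (E →L[ℝ] E →L[ℝ] ℝ) →L[ℝ] E →L[ℝ] E →L[ℝ] ℝ)) u := contDiffAt_const
  exact (h1.add h2).sub (h3.clm_comp h2)

theorem differentiableAt_christoffel [FiniteDimensional ℝ E] (hG : IsMetricOn G U) (hu : u ∈ U) :
    DifferentiableAt ℝ (christoffel G) u := by
  have : CompleteSpace E := FiniteDimensional.complete ℝ E
  have h1 : ContDiffAt ℝ 1 (fun u => (G u).inverse) u :=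
    ((hG.isInvertible u hu).contDiffAt_map_inverse).comp u
      ((hG.contDiffOn.contDiffAt (hG.isOpen.mem_nhds hu)).of_le (by norm_cast))
  have h2 : ContDiffAt ℝ 1
      (fun u => ContinuousLinearMap.compL ℝ E (E →L[ℝ] ℝ) E (G u).inverse) u :=
    (ContinuousLinearMap.compL ℝ E (E →L[ℝ] ℝ) E).contDiff.contDiffAt.comp u h1
  exact ((h2.clm_comp (hG.contDiffAt_christoffelLower hu)).const_smul (1 / 2 : ℝ)).differentiableAt
    (by simp)

end IsMetricOn

/-! ### Dependence on germs and directional derivatives -/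

section Germ

variable {G G' : E → E →L[ℝ] E →L[ℝ] ℝ} {u : E}

theorem Filter.EventuallyEq.christoffel (h : G =ᶠ[𝓝 u] G') :
    christoffel G =ᶠ[𝓝 u] christoffel G' := by
  filter_upwards [h, h.fderiv (𝕜 := ℝ)] with x h1 h2
  simp only [_root_.christoffel, christoffelLower, h1, h2]

theorem Filter.EventuallyEq.localRicci_eq (h : G =ᶠ[𝓝 u] G') (y z : E) :
    localRicci G u y z = localRicci G' u y z := by
  simp only [localRicci, curvatureEnd, h.christoffel.eq_of_nhds, h.christoffel.fderiv_eq]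

theorem Filter.EventuallyEq.localHessian_eq (h : G =ᶠ[𝓝 u] G') (k : E → ℝ) (y z : E) :
    localHessian G k u y z = localHessian G' k u y z := by
  simp only [localHessian, h.christoffel.eq_of_nhds]

/-- Derivatives of components of the Christoffel symbols can be computed along lines. -/
theorem IsMetricOn.map_fderiv_christoffel_eq [FiniteDimensional ℝ E] {W : Type*}
    [NormedAddCommGroup W] [NormedSpace ℝ W] {U : Set E} (hG : IsMetricOn G U) (hu : u ∈ U)
    {x y z : E} (ℓ : E →L[ℝ] W) {k : ℝ → W} {k' : W} (hk : HasDerivAt k k' 0)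
    (h : ∀ t : ℝ, u + t • x ∈ U → ℓ (christoffel G (u + t • x) y z) = k t) :
    ℓ (fderiv ℝ (christoffel G) u x y z) = k' := by
  have h1 : HasDerivAt (fun t : ℝ => christoffel G (u + t • x)) (fderiv ℝ (christoffel G) u x) 0 :=
    (hG.differentiableAt_christoffel hu).hasFDerivAt.hasLineDerivAt x
  have h2 := (h1.clm_apply (hasDerivAt_const (0 : ℝ) y)).clm_apply (hasDerivAt_const (0 : ℝ) z)
  have h3 : HasDerivAt (fun t : ℝ => ℓ (christoffel G (u + t • x) y z))
      (ℓ (fderiv ℝ (christoffel G) u x y z)) 0 := by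
    simpa [Function.comp_def] using ℓ.hasFDerivAt.comp_hasDerivAt (0 : ℝ) h2
  have hc : Filter.Tendsto (fun t : ℝ => u + t • x) (𝓝 0) (𝓝 u) := by
    have : Continuous fun t : ℝ => u + t • x := by fun_prop
    simpa using this.tendsto 0
  refine h3.unique (hk.congr_of_eventuallyEq ?_)
  filter_upwards [hc (hG.isOpen.mem_nhds hu)] with t ht using h t ht

end Germ

/-! ### Christoffel symbols of a warped product -/

/-- The warped product, with warping function `φ`, of fields of bilinear forms `A` on `E` and `C`
on `E'`. -/
def warpedLocal (A : E → E →L[ℝ] E →L[ℝ] ℝ) (C : E' → E' →L[ℝ] E' →L[ℝ] ℝ) (φ : E → ℝ)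
    (u : E × E') : E × E' →L[ℝ] E × E' →L[ℝ] ℝ :=
  ContinuousLinearMap.precomp ℝ (ContinuousLinearMap.fst ℝ E E') ∘L
      (A u.1) ∘L ContinuousLinearMap.fst ℝ E E'
    + (φ u.1) ^ 2 • (ContinuousLinearMap.precomp ℝ (ContinuousLinearMap.snd ℝ E E') ∘L
      (C u.2) ∘L ContinuousLinearMap.snd ℝ E E')

variable {A : E → E →L[ℝ] E →L[ℝ] ℝ} {C : E' → E' →L[ℝ] E' →L[ℝ] ℝ} {φ : E → ℝ} {u : E × E'}

theorem warpedLocal_apply (v w : E × E') :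
    warpedLocal A C φ u v w = A u.1 v.1 w.1 + φ u.1 ^ 2 * C u.2 v.2 w.2 := rfl

theorem fderiv_warpedLocal_apply (hA : DifferentiableAt ℝ A u.1) (hC : DifferentiableAt ℝ C u.2)
    (hφ : DifferentiableAt ℝ φ u.1) (hG : DifferentiableAt ℝ (warpedLocal A C φ) u)
    (x v w : E × E') :
    fderiv ℝ (warpedLocal A C φ) u x v w
      = fderiv ℝ A u.1 x.1 v.1 w.1 + φ u.1 ^ 2 * fderiv ℝ C u.2 x.2 v.2 w.2
        + 2 * φ u.1 * fderiv ℝ φ u.1 x.1 * C u.2 v.2 w.2 := by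
  have e1 : HasFDerivAt (fun u => warpedLocal A C φ u v w)
      (((fderiv ℝ (warpedLocal A C φ) u).flip v).flip w) u := by
    simpa using (hG.hasFDerivAt.clm_apply (hasFDerivAt_const v u)).clm_apply
      (hasFDerivAt_const w u)
  have dA := hA.hasFDerivAt.comp u (hasFDerivAt_fst (𝕜 := ℝ) (p := u))
  have dC := hC.hasFDerivAt.comp u (hasFDerivAt_snd (𝕜 := ℝ) (p := u))
  have dφ := hφ.hasFDerivAt.comp u (hasFDerivAt_fst (𝕜 := ℝ) (p := u))
  have dA' := (dA.clm_apply (hasFDerivAt_const v.1 u)).clm_apply (hasFDerivAt_const w.1 u)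
  have dC' := (dC.clm_apply (hasFDerivAt_const v.2 u)).clm_apply (hasFDerivAt_const w.2 u)
  have e2 := dA'.add ((dφ.pow 2).mul dC')
  have e3 := congrArg (fun T : E × E' →L[ℝ] ℝ => T x) (e1.unique e2)
  simp at e3
  rw [e3]
  ring

theorem isInvertible_warpedLocal (hA : (A u.1).IsInvertible) (hC : (C u.2).IsInvertible)
    (hφ : φ u.1 ≠ 0) [FiniteDimensional ℝ E] [FiniteDimensional ℝ E'] :
    (warpedLocal A C φ u).IsInvertible := by
  refine isInvertible_of_nondegenerate _ fun v hv => Prod.ext ?_ ?_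
  · refine hA.bijective.1 (ContinuousLinearMap.ext fun w => ?_)
    simpa [warpedLocal_apply] using hv (w, 0)
  · refine hC.bijective.1 (ContinuousLinearMap.ext fun w => ?_)
    simpa [warpedLocal_apply, hφ] using hv (0, w)

theorem IsMetricOn.warpedLocal [FiniteDimensional ℝ E] [FiniteDimensional ℝ E']
    {U : Set E} {V : Set E'} (hA : IsMetricOn A U) (hC : IsMetricOn C V)
    (hφ : ContDiffOn ℝ ∞ φ U) (hφ0 : ∀ x ∈ U, φ x ≠ 0) :
    IsMetricOn (warpedLocal A C φ) (U ×ˢ V) where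
  isOpen := hA.isOpen.prod hC.isOpen
  contDiffOn := by
    have s1 := hA.contDiffOn.comp contDiff_fst.contDiffOn (fun u (hu : u ∈ U ×ˢ V) => hu.1)
    have s2 := hC.contDiffOn.comp contDiff_snd.contDiffOn (fun u (hu : u ∈ U ×ˢ V) => hu.2)
    have s3 := hφ.comp contDiff_fst.contDiffOn (fun u (hu : u ∈ U ×ˢ V) => hu.1)
    exact (contDiffOn_const.clm_comp (s1.clm_comp contDiffOn_const)).add
      ((s3.pow 2).smul (contDiffOn_const.clm_comp (s2.clm_comp contDiffOn_const)))
  isInvertible u hu := isInvertible_warpedLocal (hA.isInvertible _ hu.1) (hC.isInvertible _ hu.2)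
    (hφ0 _ hu.1)

section Warped

variable [FiniteDimensional ℝ E] [FiniteDimensional ℝ E'] {U : Set E} {V : Set E'}

/-- The Levi-Civita connection of a warped product in coordinates; `(A u.1).inverse (fderiv ℝ φ u.1)`
is the gradient of the warping function. -/
theorem christoffel_warpedLocal (hA : IsMetricOn A U) (hC : IsMetricOn C V)
    (hφ : ContDiffOn ℝ ∞ φ U) (hφ0 : ∀ x ∈ U, φ x ≠ 0) (hu : u ∈ U ×ˢ V) (v w : E × E') :
    christoffel (warpedLocal A C φ) u v w
      = (christoffel A u.1 v.1 w.1
          - (φ u.1 * C u.2 v.2 w.2) • (A u.1).inverse (fderiv ℝ φ u.1),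
        christoffel C u.2 v.2 w.2
          + (fderiv ℝ φ u.1 v.1 / φ u.1) • w.2 + (fderiv ℝ φ u.1 w.1 / φ u.1) • v.2) := by
  have hG := hA.warpedLocal hC hφ hφ0
  have h0 := hφ0 _ hu.1
  have dφ : DifferentiableAt ℝ φ u.1 :=
    (hφ.contDiffAt (hA.isOpen.mem_nhds hu.1)).differentiableAt (by simp)
  have dG := fderiv_warpedLocal_apply (hA.differentiableAt hu.1) (hC.differentiableAt hu.2) dφ
    (hG.differentiableAt hu)
  rw [christoffel_apply, ← map_smul, (hG.isInvertible u hu).inverse_apply_eq]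
  ext z
  all_goals
    simp only [ContinuousLinearMap.comp_apply, ContinuousLinearMap.inl_apply,
      ContinuousLinearMap.inr_apply, smul_apply, christoffelLower_apply,
      warpedLocal_apply, dG, map_zero, zero_apply, map_sub, map_add, map_smul, christoffel_apply,
      sub_apply, add_apply, smul_eq_mul,
      (hA.isInvertible _ hu.1).self_apply_inverse, (hC.isInvertible _ hu.2).self_apply_inverse]
    field_simp
    ring

/-! ### Ricci curvature and Hessian of a warped product -/

/-- The trace of an endomorphism of a product is the sum of the traces of its diagonal blocks. -/
theorem trace_prod_eq_add (L : E × E' →ₗ[ℝ] E × E') :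
    LinearMap.trace ℝ (E × E') L
      = LinearMap.trace ℝ E (LinearMap.fst ℝ E E' ∘ₗ L ∘ₗ LinearMap.inl ℝ E E')
        + LinearMap.trace ℝ E' (LinearMap.snd ℝ E E' ∘ₗ L ∘ₗ LinearMap.inr ℝ E E') := by
  have h : L = L ∘ₗ (LinearMap.inl ℝ E E' ∘ₗ LinearMap.fst ℝ E E')
      + L ∘ₗ (LinearMap.inr ℝ E E' ∘ₗ LinearMap.snd ℝ E E') := by
    refine LinearMap.ext fun x => ?_
    simp [← map_add]
  conv_lhs => rw [h, map_add, ← LinearMap.comp_assoc, ← LinearMap.comp_assoc,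
    LinearMap.trace_comp_comm' (LinearMap.fst ℝ E E'),
    LinearMap.trace_comp_comm' (LinearMap.snd ℝ E E')]

/-- Horizontal and vertical directions are orthogonal for the Ricci tensor: the diagonal blocks of
`x ↦ R(x, y) z` vanish if `y` is horizontal and `z` is vertical. -/
theorem localRicci_warpedLocal_mixed (hA : IsMetricOn A U) (hC : IsMetricOn C V)
    (hφ : ContDiffOn ℝ ∞ φ U) (hφ0 : ∀ x ∈ U, φ x ≠ 0) (hu : u ∈ U ×ˢ V) (v : E) (w : E') :
    localRicci (warpedLocal A C φ) u (v, 0) (0, w) = 0 := by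
  have hG := hA.warpedLocal hC hφ hφ0
  have Γ := fun u' (hu' : u' ∈ U ×ˢ V) => christoffel_warpedLocal hA hC hφ hφ0 hu'
  have b1 : LinearMap.fst ℝ E E' ∘ₗ
      (curvatureEnd (warpedLocal A C φ) u (v, 0) (0, w) : E × E' →ₗ[ℝ] E × E') ∘ₗ
      LinearMap.inl ℝ E E' = 0 := by
    ext x
    have d1 := hG.map_fderiv_christoffel_eq hu (x := (x, 0)) (y := (v, 0)) (z := (0, w))
      (ContinuousLinearMap.fst ℝ E E') (hasDerivAt_const 0 0) (fun t ht => by rw [Γ _ ht]; simp)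
    have d2 := hG.map_fderiv_christoffel_eq hu (x := (v, 0)) (y := (x, 0)) (z := (0, w))
      (ContinuousLinearMap.fst ℝ E E') (hasDerivAt_const 0 0) (fun t ht => by rw [Γ _ ht]; simp)
    simp only [ContinuousLinearMap.coe_fst'] at d1 d2
    simp [curvatureEnd_apply, d1, d2, Γ u hu]
  have b2 : LinearMap.snd ℝ E E' ∘ₗ
      (curvatureEnd (warpedLocal A C φ) u (v, 0) (0, w) : E × E' →ₗ[ℝ] E × E') ∘ₗ
      LinearMap.inr ℝ E E' = 0 := by
    ext x
    have d1 := hG.map_fderiv_christoffel_eq hu (x := (0, x)) (y := (v, 0)) (z := (0, w))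
      (ContinuousLinearMap.snd ℝ E E')
      (hasDerivAt_const 0 ((fderiv ℝ φ u.1 v / φ u.1) • w)) (fun t ht => by rw [Γ _ ht]; simp)
    have d2 := hG.map_fderiv_christoffel_eq hu (x := (v, 0)) (y := (0, x)) (z := (0, w))
      (ContinuousLinearMap.snd ℝ E E')
      (hasDerivAt_const 0 (christoffel C u.2 x w)) (fun t ht => by rw [Γ _ ht]; simp)
    simp only [ContinuousLinearMap.coe_snd'] at d1 d2
    simp [curvatureEnd_apply, d1, d2, Γ u hu]
  rw [localRicci, trace_prod_eq_add, b1, b2, map_zero, map_zero, add_zero]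

/-- The horizontal part of the Ricci tensor of a warped product depends only on the base. -/
theorem localRicci_warpedLocal_horizontal (hA : IsMetricOn A U) (hC : IsMetricOn C V)
    (hφ : ContDiffOn ℝ ∞ φ U) (hφ0 : ∀ x ∈ U, φ x ≠ 0) (hu : u ∈ U ×ˢ V) (v w : E) :
    localRicci (warpedLocal A C φ) u (v, 0) (w, 0)
      = localRicci A u.1 v w
        - localHessian A φ u.1 v w / φ u.1 * Module.finrank ℝ E' := by
  have hG := hA.warpedLocal hC hφ hφ0
  have Γ := fun u' (hu' : u' ∈ U ×ˢ V) => christoffel_warpedLocal hA hC hφ hφ0 hu'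
  have h0 := hφ0 _ hu.1
  have cφ : ContDiffAt ℝ ∞ φ u.1 := hφ.contDiffAt (hA.isOpen.mem_nhds hu.1)
  have b1 : LinearMap.fst ℝ E E' ∘ₗ
      (curvatureEnd (warpedLocal A C φ) u (v, 0) (w, 0) : E × E' →ₗ[ℝ] E × E') ∘ₗ
      LinearMap.inl ℝ E E' = (curvatureEnd A u.1 v w : E →ₗ[ℝ] E) := by
    ext x
    have key : ∀ x y z : E,
        (fderiv ℝ (christoffel (warpedLocal A C φ)) u (x, 0) (y, 0) (z, 0)).1
          = fderiv ℝ (christoffel A) u.1 x y z := by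
      intro x y z
      have e : HasDerivAt (fun t : ℝ => christoffel A (u.1 + t • x) y z)
          (fderiv ℝ (christoffel A) u.1 x y z) 0 := by
        have h1 : HasDerivAt (fun t : ℝ => christoffel A (u.1 + t • x))
            (fderiv ℝ (christoffel A) u.1 x) 0 :=
          (hA.differentiableAt_christoffel hu.1).hasFDerivAt.hasLineDerivAt x
        simpa using (h1.clm_apply (hasDerivAt_const (0 : ℝ) y)).clm_apply
          (hasDerivAt_const (0 : ℝ) z)
      exact hG.map_fderiv_christoffel_eq hu (x := (x, 0)) (y := (y, 0)) (z := (z, 0))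
        (ContinuousLinearMap.fst ℝ E E') e (fun t ht => by rw [Γ _ ht]; simp)
    simp [curvatureEnd_apply, key, Γ u hu]
  have b2 : LinearMap.snd ℝ E E' ∘ₗ
      (curvatureEnd (warpedLocal A C φ) u (v, 0) (w, 0) : E × E' →ₗ[ℝ] E × E') ∘ₗ
      LinearMap.inr ℝ E E' = (-(localHessian A φ u.1 v w / φ u.1)) • LinearMap.id := by
    ext x
    have d1 := hG.map_fderiv_christoffel_eq hu (x := (0, x)) (y := (v, 0)) (z := (w, 0))
      (ContinuousLinearMap.snd ℝ E E') (hasDerivAt_const 0 0) (fun t ht => by rw [Γ _ ht]; simp)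
    have e : HasDerivAt
        (fun t : ℝ => (fderiv ℝ φ (u.1 + t • v) w / φ (u.1 + t • v)) • x)
        (((fderiv ℝ (fderiv ℝ φ) u.1 v w * φ u.1 - fderiv ℝ φ u.1 w * fderiv ℝ φ u.1 v)
          / φ u.1 ^ 2) • x) 0 := by
      have h1 : HasDerivAt (fun t : ℝ => fderiv ℝ φ (u.1 + t • v))
          (fderiv ℝ (fderiv ℝ φ) u.1 v) 0 :=
        ((cφ.fderiv_right (m := 1) (by norm_cast)).differentiableAt
          (by simp)).hasFDerivAt.hasLineDerivAt v
      have h2 : HasDerivAt (fun t : ℝ => φ (u.1 + t • v)) (fderiv ℝ φ u.1 v) 0 :=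
        (cφ.differentiableAt (by simp)).hasFDerivAt.hasLineDerivAt v
      have h3 := (h1.clm_apply (hasDerivAt_const (0 : ℝ) w)).div h2 (by simpa using h0)
      simpa using h3.smul_const x
    have d2 := hG.map_fderiv_christoffel_eq hu (x := (v, 0)) (y := (0, x)) (z := (w, 0))
      (ContinuousLinearMap.snd ℝ E E') e (fun t ht => by rw [Γ _ ht]; simp)
    simp only [ContinuousLinearMap.coe_snd'] at d1 d2
    simp only [LinearMap.comp_apply, LinearMap.inr_apply, ContinuousLinearMap.coe_coe,
      LinearMap.snd_apply, curvatureEnd_apply, Prod.snd_add, Prod.snd_sub, d1, d2, Γ u hu,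
      map_zero, zero_apply, mul_zero, zero_smul, smul_zero, zero_div, add_zero, zero_add,
      sub_zero, LinearMap.smul_apply, LinearMap.id_apply, localHessian, zero_sub, smul_smul]
    rw [← neg_smul, ← add_smul, ← sub_smul]
    congr 1
    field_simp
    ring
  rw [localRicci, trace_prod_eq_add, b1, b2, map_smul, LinearMap.trace_id, localRicci, smul_eq_mul]
  ring

theorem localHessian_warpedLocal_mixed (hA : IsMetricOn A U) (hC : IsMetricOn C V)
    (hφ : ContDiffOn ℝ ∞ φ U) (hφ0 : ∀ x ∈ U, φ x ≠ 0) (hu : u ∈ U ×ˢ V) (k : E × E' → ℝ)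
    (v : E) (w : E') :
    localHessian (warpedLocal A C φ) k u (v, 0) (0, w)
      = fderiv ℝ (fderiv ℝ k) u (v, 0) (0, w)
        - fderiv ℝ φ u.1 v / φ u.1 * fderiv ℝ k u (0, w) := by
  have : ((0 : E), (fderiv ℝ φ u.1 v / φ u.1) • w) = (fderiv ℝ φ u.1 v / φ u.1) • ((0 : E), w) := by
    simp
  rw [localHessian, christoffel_warpedLocal hA hC hφ hφ0 hu]
  simp only [map_zero, zero_apply, mul_zero, zero_smul, smul_zero, zero_div, add_zero, zero_add,
    sub_zero, this, map_smul, smul_eq_mul]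

/-- The horizontal part of the Hessian of a function on a warped product is the Hessian of its
restriction to a horizontal leaf. -/
theorem localHessian_warpedLocal_horizontal (hA : IsMetricOn A U) (hC : IsMetricOn C V)
    (hφ : ContDiffOn ℝ ∞ φ U) (hφ0 : ∀ x ∈ U, φ x ≠ 0) (hu : u ∈ U ×ˢ V) {k : E × E' → ℝ}
    (hk : ContDiffAt ℝ 2 k u) (v w : E) :
    localHessian (warpedLocal A C φ) k u (v, 0) (w, 0)
      = localHessian A (fun x => k (x, u.2)) u.1 v w := by
  have hi : ∀ x : E, HasFDerivAt (fun x : E => (x, u.2)) (ContinuousLinearMap.inl ℝ E E') x :=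
    fun x => hasFDerivAt_prodMk_left x u.2
  have h1 : fderiv ℝ (fun x => k (x, u.2)) =ᶠ[𝓝 u.1]
      fun x => (fderiv ℝ k (x, u.2)) ∘L ContinuousLinearMap.inl ℝ E E' := by
    have ev : ∀ᶠ q in 𝓝 u, DifferentiableAt ℝ k q :=
      (hk.eventually (by simp)).mono fun q hq => hq.differentiableAt (by simp)
    have hc : Filter.Tendsto (fun x : E => (x, u.2)) (𝓝 u.1) (𝓝 u) := (hi u.1).continuousAt
    filter_upwards [hc ev] with x hx
    exact (hx.hasFDerivAt.comp x (hi x)).fderiv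
  have h2 : HasFDerivAt (fun x => fderiv ℝ k (x, u.2))
      ((fderiv ℝ (fderiv ℝ k) u) ∘L ContinuousLinearMap.inl ℝ E E') u.1 :=
    ((hk.fderiv_right (m := 1) (by norm_num)).differentiableAt
      (by simp)).hasFDerivAt.comp u.1 (hi u.1)
  have h3 := h2.clm_comp (hasFDerivAt_const (ContinuousLinearMap.inl ℝ E E') u.1)
  simp only [localHessian, christoffel_warpedLocal hA hC hφ hφ0 hu, h1.fderiv_eq, h3.fderiv,
    h1.eq_of_nhds]
  simp

end Warped
theorem localHessian_add_const_mul {G : E → E →L[ℝ] E →L[ℝ] ℝ} {a : E} {k k' : E → ℝ} (c : ℝ)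
    (hk : ContDiffAt ℝ 2 k a) (hk' : ContDiffAt ℝ 2 k' a) (v w : E) :
    localHessian G (fun x => k x + c * k' x) a v w
      = localHessian G k a v w + c * localHessian G k' a v w := by
  have ev : fderiv ℝ (fun x => k x + c * k' x) =ᶠ[𝓝 a] fun x => fderiv ℝ k x + c • fderiv ℝ k' x := by
    filter_upwards [hk.eventually (by simp), hk'.eventually (by simp)] with x h1 h2
    exact ((h1.differentiableAt (by simp)).hasFDerivAt.add
      ((h2.differentiableAt (by simp)).hasFDerivAt.const_mul c)).fderiv
  have d1 := ((hk.fderiv_right (m := 1) (by norm_num)).differentiableAt (by simp)).hasFDerivAt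
  have d2 := ((hk'.fderiv_right (m := 1) (by norm_num)).differentiableAt (by simp)).hasFDerivAt
  have d3 := (d1.add (d2.const_smul c)).fderiv
  simp only [localHessian, ev.fderiv_eq, ev.eq_of_nhds]
  -- `d3` is stated for a sum of functions, the goal for the function of pointwise sums
  erw [d3]
  simp
  ring

/-- The mixed component of the soliton equation says that the vertical derivative of the potential,
divided by the warping function, does not vary along the base. -/
theorem hasFDerivAt_vertical_div {k : E × E' → ℝ} {φ : E → ℝ} {u : E × E'}
    (hk : ContDiffAt ℝ 2 k u) (hφ : DifferentiableAt ℝ φ u.1) (hφ0 : φ u.1 ≠ 0) (w : E')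
    (h : ∀ v : E, fderiv ℝ (fderiv ℝ k) u (v, 0) (0, w)
      = fderiv ℝ φ u.1 v / φ u.1 * fderiv ℝ k u (0, w)) :
    HasFDerivAt (fun x => fderiv ℝ (fun s => k (x, s)) u.2 w / φ x) (0 : E →L[ℝ] ℝ) u.1 := by
  have hi : HasFDerivAt (fun x : E => (x, u.2)) (ContinuousLinearMap.inl ℝ E E') u.1 :=
    hasFDerivAt_prodMk_left u.1 u.2
  have ev : (fun x => fderiv ℝ (fun s => k (x, s)) u.2 w / φ x) =ᶠ[𝓝 u.1]
      fun x => fderiv ℝ k (x, u.2) (0, w) / φ x := by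
    have ev : ∀ᶠ q in 𝓝 u, DifferentiableAt ℝ k q :=
      (hk.eventually (by simp)).mono fun q hq => hq.differentiableAt (by simp)
    have hc : Filter.Tendsto (fun x : E => (x, u.2)) (𝓝 u.1) (𝓝 u) := hi.continuousAt
    filter_upwards [hc ev] with x hx
    have e := (hx.hasFDerivAt.comp u.2 (hasFDerivAt_prodMk_right x u.2)).fderiv
    simp only [Function.comp_def] at e
    rw [e]
    simp
  refine HasFDerivAt.congr_of_eventuallyEq ?_ ev
  have d1 : HasFDerivAt (fun x => fderiv ℝ k (x, u.2))
      ((fderiv ℝ (fderiv ℝ k) u) ∘L ContinuousLinearMap.inl ℝ E E') u.1 :=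
    ((hk.fderiv_right (m := 1) (by norm_num)).differentiableAt (by simp)).hasFDerivAt.comp u.1 hi
  have d2 := (d1.clm_apply (hasFDerivAt_const ((0 : E), w) u.1)).mul ((hasDerivAt_inv hφ0).comp_hasFDerivAt u.1 hφ.hasFDerivAt)
  simp only [div_eq_mul_inv]
  refine d2.congr_fderiv (ContinuousLinearMap.ext fun v => ?_)
  simp [h]
  field_simp
  simp

end Local

/-! ### Functions and metrics in the charts of a manifold -/

section Constant

variable {E : Type*} [NormedAddCommGroup E] [NormedSpace ℝ E]
  {H : Type*} [TopologicalSpace H] {I : ModelWithCorners ℝ E H}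
  {M : Type*} [TopologicalSpace M] [ChartedSpace H M] [IsManifold I ∞ M]

theorem contDiffOn_comp_extChartAt_symm {f : M → ℝ} (hf : ContMDiff I 𝓘(ℝ, ℝ) ∞ f) (x : M) :
    ContDiffOn ℝ ∞ (f ∘ (extChartAt I x).symm) (extChartAt I x).target :=
  (hf.comp_contMDiffOn (contMDiffOn_extChartAt_symm x)).contDiffOn

variable [I.Boundaryless]

/-- A function with vanishing differential on a connected manifold is constant. The hypothesis is only
about the derivative at the centre of each chart, since tensors at a point are computed in the chart
around that point. -/
theorem eq_of_forall_hasFDerivAt_comp_extChartAt_symm [PreconnectedSpace M] {q : M → ℝ}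
    (hq : ∀ x, HasFDerivAt (q ∘ (extChartAt I x).symm) (0 : E →L[ℝ] ℝ) (extChartAt I x x))
    (x y : M) : q x = q y := by
  have : IsManifold I 1 M := .of_le (n := ∞) (by norm_cast)
  have hm : ∀ x, HasMFDerivAt I 𝓘(ℝ, ℝ) q x 0 := by
    intro x
    refine ⟨?_, ?_⟩
    · have h1 := ContinuousAt.comp (hq x).continuousAt (continuousAt_extChartAt (I := I) x)
      refine h1.congr ?_
      filter_upwards [extChartAt_source_mem_nhds (I := I) x] with z hz
      exact congrArg q ((extChartAt I x).left_inv hz)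
    · exact (hq x).hasFDerivWithinAt
  refine IsLocallyConstant.apply_eq_of_preconnectedSpace ?_ x y
  refine (IsLocallyConstant.iff_eventually_eq q).2 fun x => ?_
  have hd : ∀ u ∈ (extChartAt I x).target,
      HasFDerivAt (q ∘ (extChartAt I x).symm) (0 : E →L[ℝ] ℝ) u := by
    intro u hu
    have h1 : MDifferentiableAt 𝓘(ℝ, E) I (extChartAt I x).symm u := by
      have := mdifferentiableWithinAt_extChartAt_symm hu
      rwa [ModelWithCorners.range_eq_univ, mdifferentiableWithinAt_univ] at this
    have h2 := (hm ((extChartAt I x).symm u)).comp u h1.hasMFDerivAt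
    rw [ContinuousLinearMap.zero_comp] at h2
    exact h2.hasFDerivAt
  have ho := (isOpen_extChartAt_target (I := I) x).isOpen_inter_preimage_of_fderiv_eq_zero
    (fun u hu => (hd u hu).differentiableAt.differentiableWithinAt)
    (fun u hu => (hd u hu).fderiv) {q x}
  have hn := (continuousAt_extChartAt (I := I) x).preimage_mem_nhds (ho.mem_nhds
    ⟨mem_extChartAt_target x, by simp⟩)
  filter_upwards [hn, extChartAt_source_mem_nhds (I := I) x] with z hz hz'
  exact (congrArg q ((extChartAt I x).left_inv hz')).symm.trans hz.2

theorem SemiRiemannianMetric.isMetricOn_coordForm [FiniteDimensional ℝ E]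
    (g : SemiRiemannianMetric I M) (p : M) :
    IsMetricOn (coordForm I g.val p) (extChartAt I p).target where
  isOpen := isOpen_extChartAt_target p
  contDiffOn := g.smooth p
  isInvertible u hu := by
    have : IsManifold I 1 M := .of_le (n := ∞) (by norm_cast)
    have hD : (mfderiv 𝓘(ℝ, E) I (extChartAt I p).symm u).IsInvertible := by
      have := isInvertible_mfderivWithin_extChartAt_symm (I := I) hu
      rwa [ModelWithCorners.range_eq_univ, mfderivWithin_univ] at this
    refine isInvertible_of_nondegenerate _ fun v hv => ?_
    refine hD.bijective.1 ((g.nondegenerate _ _ fun w => ?_).trans (map_zero _).symm)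
    obtain ⟨w, rfl⟩ := hD.bijective.2 w
    exact hv w

end Constant

/-! ### The soliton equation on a warped product -/

section Soliton

variable {EB : Type*} [NormedAddCommGroup EB] [NormedSpace ℝ EB]
  {HB : Type*} [TopologicalSpace HB] {IB : ModelWithCorners ℝ EB HB} [IB.Boundaryless]
  {EF : Type*} [NormedAddCommGroup EF] [NormedSpace ℝ EF]
  {HF : Type*} [TopologicalSpace HF] {IF : ModelWithCorners ℝ EF HF} [IF.Boundaryless]
  {B : Type*} [TopologicalSpace B] [ChartedSpace HB B] [IsManifold IB ∞ B]
  {F : Type*} [TopologicalSpace F] [ChartedSpace HF F] [IsManifold IF ∞ F]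
  {gB : SemiRiemannianMetric IB B} {gF : SemiRiemannianMetric IF F}
  {f : B → ℝ} {hf : ContMDiff IB 𝓘(ℝ, ℝ) ∞ f} {hpos : ∀ x, 0 < f x}
  {h : B × F → ℝ}

variable (IB IF) in
/-- A function on `B × F` in the product of the charts around `x` and `y`. -/
def coordFun (h : B × F → ℝ) (x : B) (y : F) (u : EB × EF) : ℝ :=
  h ((extChartAt IB x).symm u.1, (extChartAt IF y).symm u.2)

theorem contDiffAt_coordFun (hh : ContMDiff (IB.prod IF) 𝓘(ℝ, ℝ) 2 h) (x : B) (y : F) :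
    ContDiffAt ℝ 2 (coordFun IB IF h x y) (extChartAt IB x x, extChartAt IF y y) := by
  have : IsManifold (IB.prod IF) ∞ (B × F) := inferInstance
  have : IsManifold (IB.prod IF) 2 (B × F) := .of_le (n := ∞) (by norm_cast)
  have h1 : ContDiffOn ℝ 2 (h ∘ (extChartAt (IB.prod IF) (x, y)).symm)
      (extChartAt (IB.prod IF) (x, y)).target :=
    (hh.comp_contMDiffOn (contMDiffOn_extChartAt_symm (x, y))).contDiffOn
  have h2 := h1.contDiffAt (extChartAt_target_mem_nhds (x, y))
  rw [extChartAt_prod] at h2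
  exact h2

theorem coordForm_warpedProduct_eventuallyEq (x : B) (y : F) :
    coordForm (IB.prod IF) (warpedProduct gB gF f hf hpos).val (x, y)
      =ᶠ[𝓝 (extChartAt IB x x, extChartAt IF y y)]
    warpedLocal (coordForm IB gB.val x) (coordForm IF gF.val y) (f ∘ (extChartAt IB x).symm) := by
  have h1 := extChartAt_target_mem_nhds (I := IB.prod IF) (x, y)
  have h2 : extChartAt (IB.prod IF) (x, y) (x, y) = (extChartAt IB x x, extChartAt IF y y) := by
    rw [extChartAt_prod]; rfl
  rw [h2] at h1
  filter_upwards [h1] with u hu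
  exact coordForm_warpedForm gB.val gF.val f (x, y) u hu

/-- The soliton equation in the product of the charts around `x` and `y`. -/
theorem soliton_local {ρ : ℝ}
    (hρ : ∀ (p : B × F) (v w : TangentSpace (IB.prod IF) p),
      (warpedProduct gB gF f hf hpos).ricci p v w
        + (warpedProduct gB gF f hf hpos).hessian h p v w
        = ρ * (warpedProduct gB gF f hf hpos).val p v w) (x : B) (y : F) (v w : EB × EF) :
    localRicci (warpedLocal (coordForm IB gB.val x) (coordForm IF gF.val y)
        (f ∘ (extChartAt IB x).symm)) (extChartAt IB x x, extChartAt IF y y) v w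
      + localHessian (warpedLocal (coordForm IB gB.val x) (coordForm IF gF.val y)
        (f ∘ (extChartAt IB x).symm)) (coordFun IB IF h x y)
        (extChartAt IB x x, extChartAt IF y y) v w
      = ρ * (gB.val x v.1 w.1 + f x ^ 2 * gF.val y v.2 w.2) := by
  have e := hρ (x, y) v w
  have h2 : extChartAt (IB.prod IF) (x, y) (x, y) = (extChartAt IB x x, extChartAt IF y y) := by
    rw [extChartAt_prod]; rfl
  have h3 : h ∘ (extChartAt (IB.prod IF) (x, y)).symm = coordFun IB IF h x y := by
    rw [extChartAt_prod]; rfl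
  have E := coordForm_warpedProduct_eventuallyEq (gB := gB) (gF := gF) (hf := hf) (hpos := hpos) x y
  change localRicci (coordForm (IB.prod IF) (warpedProduct gB gF f hf hpos).val (x, y))
      (extChartAt (IB.prod IF) (x, y) (x, y)) v w
    + localHessian (coordForm (IB.prod IF) (warpedProduct gB gF f hf hpos).val (x, y))
      (h ∘ (extChartAt (IB.prod IF) (x, y)).symm) (extChartAt (IB.prod IF) (x, y) (x, y)) v w
    = _ at e
  rw [h2, h3] at e
  rw [← E.localRicci_eq, ← E.localHessian_eq]
  exact e.trans (congrArg (ρ * ·) (warpedForm_apply gB.val gF.val f (x, y) v w))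

variable [FiniteDimensional ℝ EB] [FiniteDimensional ℝ EF]

/-- The potential is the warping function times a function on the fibre, up to a function on the
base. -/
theorem IsGradientRicciSoliton.sub_div_eq [PreconnectedSpace B] [PreconnectedSpace F]
    (hsol : (warpedProduct gB gF f hf hpos).IsGradientRicciSoliton h) (x x₀ : B) (y y₀ : F) :
    h (x, y) / f x - h (x₀, y) / f x₀ = h (x, y₀) / f x - h (x₀, y₀) / f x₀ := by
  obtain ⟨hh, ρ, hρ⟩ := hsol
  -- the vertical derivative of `h` at `(x, y)`, divided by `f x`, does not depend on `x`
  have hbase : ∀ (y : F) (w : EF) (x x₀ : B),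
      fderiv ℝ (fun s => h (x, (extChartAt IF y).symm s)) (extChartAt IF y y) w / f x
        = fderiv ℝ (fun s => h (x₀, (extChartAt IF y).symm s)) (extChartAt IF y y) w / f x₀ := by
    intro y w x x₀
    refine eq_of_forall_hasFDerivAt_comp_extChartAt_symm (I := IB) (q := fun x =>
      fderiv ℝ (fun s => h (x, (extChartAt IF y).symm s)) (extChartAt IF y y) w / f x) ?_ x x₀
    intro x
    have sφ := contDiffOn_comp_extChartAt_symm hf x
    have hu : ((extChartAt IB x x, extChartAt IF y y) : EB × EF) ∈
      (extChartAt IB x).target ×ˢ (extChartAt IF y).target :=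
      ⟨mem_extChartAt_target x, mem_extChartAt_target y⟩
    have h0 : ∀ u ∈ (extChartAt IB x).target, (f ∘ (extChartAt IB x).symm) u ≠ 0 :=
      fun u _ => (hpos _).ne'
    refine hasFDerivAt_vertical_div (contDiffAt_coordFun hh x y)
      ((sφ.contDiffAt (extChartAt_target_mem_nhds x)).differentiableAt (by simp))
      (h0 _ hu.1) w fun v => ?_
    have e := soliton_local hρ x y (v, 0) (0, w)
    rw [localRicci_warpedLocal_mixed (gB.isMetricOn_coordForm x) (gF.isMetricOn_coordForm y) sφ h0
        hu, localHessian_warpedLocal_mixed (gB.isMetricOn_coordForm x) (gF.isMetricOn_coordForm y)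
        sφ h0 hu] at e
    have z1 : gB.val x v (0 : EB) = 0 := map_zero (gB.val x v)
    have z2 : gF.val y (0 : EF) w = 0 := congrArg (fun T : EF →L[ℝ] ℝ => T w) (map_zero (gF.val y))
    simp only [z1, z2, mul_zero, add_zero, zero_add] at e
    exact sub_eq_zero.1 e
  refine eq_of_forall_hasFDerivAt_comp_extChartAt_symm (I := IF)
    (q := fun y => h (x, y) / f x - h (x₀, y) / f x₀) ?_ y y₀
  intro y
  have hd : ∀ x : B, DifferentiableAt ℝ (fun s => h (x, (extChartAt IF y).symm s))
      (extChartAt IF y y) := by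
    intro x
    have h1 := ((contDiffAt_coordFun hh x y).differentiableAt (by simp)).comp (extChartAt IF y y)
      (hasFDerivAt_prodMk_right (extChartAt IB x x) (extChartAt IF y y)).differentiableAt
    simpa [Function.comp_def, coordFun] using h1
  have h1 := ((hd x).hasFDerivAt.mul_const (f x)⁻¹).sub
    ((hd x₀).hasFDerivAt.mul_const (f x₀)⁻¹)
  simp only [← div_eq_mul_inv] at h1
  refine h1.congr_fderiv (ContinuousLinearMap.ext fun w => ?_)
  have := hbase y w x x₀
  simp only [div_eq_inv_mul] at this
  exact sub_eq_zero.2 this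

/-- By the horizontal component of the soliton equation, the Hessian of the potential along a
horizontal leaf does not depend on the leaf. -/
theorem IsGradientRicciSoliton.localHessian_leaf_eq
    (hsol : (warpedProduct gB gF f hf hpos).IsGradientRicciSoliton h) (x : B) (y y₀ : F)
    (v w : EB) :
    localHessian (coordForm IB gB.val x) (fun a => h ((extChartAt IB x).symm a, y))
        (extChartAt IB x x) v w
      = localHessian (coordForm IB gB.val x) (fun a => h ((extChartAt IB x).symm a, y₀))
        (extChartAt IB x x) v w := by
  obtain ⟨hh, ρ, hρ⟩ := hsol
  have key : ∀ y : F, localRicci (coordForm IB gB.val x) (extChartAt IB x x) v w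
        - localHessian (coordForm IB gB.val x) (f ∘ (extChartAt IB x).symm) (extChartAt IB x x) v w
          / f x * Module.finrank ℝ EF
        + localHessian (coordForm IB gB.val x) (fun a => h ((extChartAt IB x).symm a, y))
        (extChartAt IB x x) v w = ρ * gB.val x v w := by
    intro y
    have hu : ((extChartAt IB x x, extChartAt IF y y) : EB × EF) ∈
      (extChartAt IB x).target ×ˢ (extChartAt IF y).target :=
      ⟨mem_extChartAt_target x, mem_extChartAt_target y⟩
    have h0 : ∀ u ∈ (extChartAt IB x).target, (f ∘ (extChartAt IB x).symm) u ≠ 0 :=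
      fun u _ => (hpos _).ne'
    have sφ := contDiffOn_comp_extChartAt_symm hf x
    have e := soliton_local hρ x y (v, 0) (w, 0)
    rw [localRicci_warpedLocal_horizontal (gB.isMetricOn_coordForm x) (gF.isMetricOn_coordForm y)
        sφ h0 hu, localHessian_warpedLocal_horizontal (gB.isMetricOn_coordForm x)
        (gF.isMetricOn_coordForm y) sφ h0 hu (contDiffAt_coordFun hh x y)] at e
    have z : gF.val y (0 : EF) (0 : EF) = 0 := map_zero (gF.val y (0 : EF))
    simpa only [z, mul_zero, add_zero, coordFun, Function.comp_apply, extChartAt_to_inv] using e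
  linarith [key y, key y₀]

end Soliton

end

/-! ### Potentials that depend only on the base -/

theorem theorem1p1
    {EB : Type*} [NormedAddCommGroup EB] [NormedSpace ℝ EB] [FiniteDimensional ℝ EB]
    {HB : Type*} [TopologicalSpace HB] (IB : ModelWithCorners ℝ EB HB) [IB.Boundaryless]
    {EF : Type*} [NormedAddCommGroup EF] [NormedSpace ℝ EF] [FiniteDimensional ℝ EF]
    {HF : Type*} [TopologicalSpace HF] (IF : ModelWithCorners ℝ EF HF) [IF.Boundaryless]
    {B : Type*} [TopologicalSpace B] [ChartedSpace HB B] [IsManifold IB ∞ B] [ConnectedSpace B]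
    {F : Type*} [TopologicalSpace F] [ChartedSpace HF F] [IsManifold IF ∞ F] [ConnectedSpace F]
    (gB : SemiRiemannianMetric IB B) (gF : SemiRiemannianMetric IF F)
    (f : B → ℝ) (hf : ContMDiff IB 𝓘(ℝ, ℝ) ∞ f) (hpos : ∀ x, 0 < f x)
    (h : B × F → ℝ)
    (hsol : (warpedProduct gB gF f hf hpos).IsGradientRicciSoliton h)
    (hhess : ∃ (x : B) (v w : TangentSpace IB x), gB.hessian f x v w ≠ 0) :
    ∃ hB : B → ℝ, h = hB ∘ Prod.fst := by
  obtain ⟨x₀, v, w, hne⟩ := hhess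
  obtain ⟨y₀⟩ : Nonempty F := inferInstance
  refine ⟨fun x => h (x, y₀), funext fun ⟨x, y⟩ => ?_⟩
  -- two horizontal leaves of `h` differ by `c` times the warping function
  set c : ℝ := (h (x₀, y) - h (x₀, y₀)) / f x₀ with hc
  have hdiff : ∀ x, h (x, y) = h (x, y₀) + c * f x := by
    intro x
    have e := IsGradientRicciSoliton.sub_div_eq hsol x x₀ y y₀
    have h1 := (hpos x).ne'
    have h2 := (hpos x₀).ne'
    rw [hc]
    field_simp at e ⊢
    linarith
  have sφ : ContDiffAt ℝ 2 (f ∘ (extChartAt IB x₀).symm) (extChartAt IB x₀ x₀) :=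
    ((contDiffOn_comp_extChartAt_symm hf x₀).contDiffAt (extChartAt_target_mem_nhds x₀)).of_le
      (by norm_cast)
  have sh : ContDiffAt ℝ 2 (fun a => h ((extChartAt IB x₀).symm a, y₀)) (extChartAt IB x₀ x₀) := by
    have h1 := (contDiffAt_coordFun hsol.1 x₀ y₀).comp (extChartAt IB x₀ x₀)
      (contDiffAt_id.prodMk contDiffAt_const)
    simpa [Function.comp_def, coordFun] using h1
  have e := IsGradientRicciSoliton.localHessian_leaf_eq hsol x₀ y y₀ v w
  have e' := localHessian_add_const_mul (G := coordForm IB gB.val x₀) c sh sφ v w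
  simp only [hdiff] at e
  have hc0 : c * gB.hessian f x₀ v w = 0 := by
    have : localHessian (coordForm IB gB.val x₀) (f ∘ (extChartAt IB x₀).symm) (extChartAt IB x₀ x₀)
      v w = gB.hessian f x₀ v w := rfl
    rw [this] at e'
    simp only [Function.comp_apply] at e'
    linarith
  have hc' : c = 0 := (mul_eq_zero.1 hc0).resolve_right hne
  rw [hdiff x, hc', zero_mul, add_zero]
  rfl
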